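/- Let $G$ be a finite bipartite graph (parallel edges allowed), embedded in the oriented plane, connected and without cut vertices, with at least one edge; embeddings are considered up to isotopy, i.e. an embedding is given by the counterclockwise cyclic order of the half-edges at each vertex (a rotation system of genus zero) together with the choice of the unbounded face. A ciliation $L$ of $G$ is the choice of a preferred half-edge at every vertex; it makes the half-edges at that vertex linearly ordered, counterclockwise at black and clockwise at white vertices, starting with the preferred one, and the cilium at the vertex is drawn just before the preferred half-edge in this order, so that it points into one of the faces at the vertex. For $n\in\mathbb N$ and $q\in\mathbb C\setminus\{0\}$ let $Q=\mathrm{diag}(q^{n-1},q^{n-3},\dots,q^{-(n-1)})\in\mathrm{SL}_n(\mathbb C)$. An $\mathrm{SL}_n$-connection $\Phi$ assigns a matrix $\Phi(e)\in \mathrm{SL}_n(\mathbb C)$ to every edge $e$, used for parallel transport from the black to the white end (and $\Phi(e)^{-1}$ in the other direction). It is a quantum identity connection for $L$ if all $\Phi(e)$ are diagonal and, for every bounded face, of length $l$ and with $k$ inward-pointing cilia, the counterclockwise monodromy around the face is $Q^{\frac l2-1-k}$ from every base point. The ciliation $L$ is trivial if the identity connection $I$ (the identity matrix on every edge) is a quantum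 identity connection for $L$. Then: 1. If every bounded face of $G$, of length $l$, has exactly $\frac l2-1$ inward-pointing cilia of $L$, then $L$ is trivial (for all $n$ and $q$). 2. A ciliation $L$ of $G$ such that every bounded face of length $l$ has exactly $\frac l2-1$ inward-pointing cilia exists; in particular, a ciliation that is trivial for all $n$ and $q$ exists. -/

import Mathlib

/-- A finite connected bipartite multigraph with black vertices `B`, white vertices `W` and
edges `E`, embedded in the oriented plane, the embedding being taken up to isotopy (that is,
a rotation system of genus zero on the graph, with a choice of the unbounded face).

The half-edges are the elements of `E ⊕ E`: `Sum.inl e` is the half of `e` at its black end and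
`Sum.inr e` is the half of `e` at its white end. A half-edge is also viewed as a dart, i.e. as
its edge directed away from the vertex at which the half-edge is attached. -/
structure BipartiteRotationSystem (B W E : Type*) where
  /-- The black end of an edge. -/
  black : E → B
  /-- The white end of an edge. -/
  white : E → W
  /-- The half-edge that comes next in counterclockwise order around the same vertex. -/
  rot : Equiv.Perm (E ⊕ E)
  /-- The cycles of `rot` are exactly the sets of half-edges at the various vertices. -/
  sameCycle_rot_iff : ∀ d d' : E ⊕ E,
    rot.SameCycle d d' ↔ Sum.map black white d = Sum.map black white d'

namespace BipartiteRotationSystem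

variable {B W E : Type*} (G : BipartiteRotationSystem B W E)

/-- The vertex at which a half-edge is attached. -/
def base (d : E ⊕ E) : B ⊕ W := Sum.map G.black G.white d

/-- The underlying simple graph (parallel edges are identified), for connectivity. -/
def graph : SimpleGraph (B ⊕ W) where
  Adj u v := ∃ d : E ⊕ E, G.base d = u ∧ G.base d.swap = v
  symm := ⟨by
    rintro u v ⟨d, hu, hv⟩
    exact ⟨d.swap, hv, by simpa using hu⟩⟩
  loopless := ⟨by
    rintro u ⟨d, hu, hv⟩
    cases d <;> simp [base] at hu hv <;> simp [← hu] at hv⟩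

/-- Boundary walks with the face on the left: after the dart `d` comes the dart that leaves the
head of `d` immediately clockwise of the reversal of `d`. Around a bounded face of a plane graph
this is the counterclockwise walk. -/
def facePerm : Equiv.Perm (E ⊕ E) := (Equiv.sumComm E E).trans G.rot.symm

/-- A face, as the set of darts that have the face on their left. -/
def Face : Type _ := Quotient (Equiv.Perm.SameCycle.setoid G.facePerm)

/-- The face on the left of a dart. The angular sector at the vertex `G.base d` between the
half-edge `d` and the next one counterclockwise, `G.rot d`, lies in this face. -/
def leftFace (d : E ⊕ E) : G.Face := Quotient.mk _ d

/-- The length of a face: the length of its boundary walk. -/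
noncomputable def faceLength (f : G.Face) : ℕ := Nat.card {d : E ⊕ E // G.leftFace d = f}

end BipartiteRotationSystem

/-- A connected bipartite graph embedded in the plane, up to isotopy of the plane: a connected
rotation system whose associated closed oriented surface is a sphere (Euler characteristic `2`),
with one face singled out as the unbounded one. -/
structure PlaneBipartiteGraph (B W E : Type*) extends BipartiteRotationSystem B W E where
  connected : toBipartiteRotationSystem.graph.Connected
  euler : (Nat.card (B ⊕ W) : ℤ) - Nat.card E + Nat.card toBipartiteRotationSystem.Face = 2
  /-- The unbounded face. -/
  outer : toBipartiteRotationSystem.Face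

namespace PlaneBipartiteGraph

variable {B W E : Type*} (G : PlaneBipartiteGraph B W E)

/-- `G` has no cut vertex (`G` is connected by definition): deleting a vertex never
disconnects it. -/
def IsTwoConnected : Prop := ∀ v : B ⊕ W, (G.graph.induce {v}ᶜ).Preconnected

/-- A ciliation: a preferred half-edge at every vertex. The half-edges at a vertex are linearly
ordered starting from the preferred one, counterclockwise at black vertices and clockwise at
white vertices. -/
structure Ciliation where
  first : B ⊕ W → E ⊕ E
  base_first : ∀ v, G.base (first v) = v

variable {G}

/-- The half-edge after which, counterclockwise, the cilium at `v` is drawn. The cilium comes just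
before the preferred half-edge, in the counterclockwise order at a black vertex and in the
clockwise order at a white vertex. -/
def Ciliation.beforeCilium (L : G.Ciliation) : B ⊕ W → E ⊕ E
  | Sum.inl b => G.rot.symm (L.first (Sum.inl b))
  | Sum.inr w => L.first (Sum.inr w)

/-- The face into which the cilium at `v` points. -/
def Ciliation.ciliumFace (L : G.Ciliation) (v : B ⊕ W) : G.Face := G.leftFace (L.beforeCilium v)

/-- The number of cilia pointing into the face `f`. -/
noncomputable def Ciliation.inwardCilia (L : G.Ciliation) (f : G.Face) : ℕ :=
  Nat.card {v : B ⊕ W // L.ciliumFace v = f}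

/-- An `SL_n`-connection on a graph with edge set `E`: a matrix on every edge. -/
abbrev SLConnection (E : Type*) (n : ℕ) : Type _ := E → Matrix.SpecialLinearGroup (Fin n) ℂ

/-- Parallel transport along a dart: the matrix of the edge if the edge is traversed from black to
white, and its inverse otherwise. -/
def transport {n : ℕ} (Φ : SLConnection E n) : E ⊕ E → Matrix.SpecialLinearGroup (Fin n) ℂ
  | Sum.inl e => Φ e
  | Sum.inr e => (Φ e)⁻¹

variable (G) in
/-- The monodromy of the boundary walk, based at the tail of the dart `d`, of the face on the left
of `d`. The matrices met later are multiplied on the left. -/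
noncomputable def faceMonodromy {n : ℕ} (Φ : SLConnection E n) (d : E ⊕ E) :
    Matrix.SpecialLinearGroup (Fin n) ℂ :=
  ((List.range (G.faceLength (G.leftFace d))).map
    fun i => transport Φ ((G.facePerm ^ i) d)).reverse.prod

end PlaneBipartiteGraph

theorem det_quantumIdentityMatrix (n : ℕ) (q : ℂˣ) :
    (Matrix.diagonal fun i : Fin n => ((q ^ ((n : ℤ) - 1 - 2 * (i : ℕ)) : ℂˣ) : ℂ)).det = 1 := by
  have hsum : ∀ m : ℕ, ∀ c : ℤ, ∑ i ∈ Finset.range m, (c - 2 * (i : ℤ)) = m * c - m * (m - 1) := by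
    intro m c
    induction m with
    | zero => simp
    | succ k ih => rw [Finset.sum_range_succ, ih]; push_cast; ring
  have hprod : ∏ i ∈ Finset.range n, q ^ ((n : ℤ) - 1 - 2 * (i : ℕ))
      = q ^ ∑ i ∈ Finset.range n, ((n : ℤ) - 1 - 2 * (i : ℤ)) := by
    generalize Finset.range n = s
    induction s using Finset.induction_on with
    | empty => simp
    | insert a s ha ih => rw [Finset.prod_insert ha, Finset.sum_insert ha, zpow_add, ih]
  rw [Matrix.det_diagonal, ← Units.coe_prod,
    Fin.prod_univ_eq_prod_range (fun i : ℕ => q ^ ((n : ℤ) - 1 - 2 * (i : ℤ))) n, hprod, hsum]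
  simp

/-- The quantum identity matrix `Q = diag(q^(n-1), q^(n-3), …, q^(-(n-1)))`. -/
def quantumIdentityMatrix (n : ℕ) (q : ℂˣ) : Matrix.SpecialLinearGroup (Fin n) ℂ :=
  ⟨Matrix.diagonal fun i : Fin n => ((q ^ ((n : ℤ) - 1 - 2 * (i : ℕ)) : ℂˣ) : ℂ),
    det_quantumIdentityMatrix n q⟩

namespace BipartiteRotationSystem

variable {B W E : Type*} (G : BipartiteRotationSystem B W E)

theorem isLeft_facePerm (d : E ⊕ E) : (G.facePerm d).isLeft = !d.isLeft := by
  have h : Sum.map G.black G.white (G.facePerm d) = Sum.map G.black G.white d.swap :=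
    (G.sameCycle_rot_iff _ _).1 ⟨1, by simp [facePerm]⟩
  revert h
  cases d <;> cases G.facePerm _ <;> simp

theorem leftFace_facePerm (d : E ⊕ E) : G.leftFace (G.facePerm d) = G.leftFace d :=
  Quotient.sound (s := Equiv.Perm.SameCycle.setoid G.facePerm)
    (Equiv.Perm.SameCycle.symm ⟨1, by simp⟩)

/-- Faces of a bipartite graph have even length, so the division by `2` in the definition of a
quantum identity connection is exact. -/
theorem even_faceLength [Finite E] (f : G.Face) : Even (G.faceLength f) := by
  classical
  have e : {d : {d : E ⊕ E // G.leftFace d = f} // d.1.isLeft} ≃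
      {d : {d : E ⊕ E // G.leftFace d = f} // ¬ d.1.isLeft} :=
    { toFun := fun d => ⟨⟨G.facePerm d.1.1, by rw [leftFace_facePerm, d.1.2]⟩, by
        have := d.2; simp [isLeft_facePerm, this]⟩
      invFun := fun d => ⟨⟨G.facePerm.symm d.1.1, by
          rw [← leftFace_facePerm, Equiv.apply_symm_apply, d.1.2]⟩, by
        have h1 := d.2
        have h2 := G.isLeft_facePerm (G.facePerm.symm d.1.1)
        rw [Equiv.apply_symm_apply] at h2
        simp_all⟩
      left_inv := fun d => by simp
      right_inv := fun d => by simp }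
  refine ⟨Nat.card {d : {d : E ⊕ E // G.leftFace d = f} // d.1.isLeft}, ?_⟩
  rw [faceLength, ← Nat.card_congr (Equiv.sumCompl
    (fun d : {d : E ⊕ E // G.leftFace d = f} => (d.1.isLeft : Prop))), Nat.card_sum,
    ← Nat.card_congr e]

end BipartiteRotationSystem

namespace PlaneBipartiteGraph

variable {B W E : Type*} {G : PlaneBipartiteGraph B W E}

/-- `Φ` is a quantum identity connection for the ciliation `L`: it is diagonal, and for every
bounded face, of length `l` and with `k` inward-pointing cilia, the counterclockwise monodromy
from every base point is `Q ^ (l / 2 - 1 - k)`. -/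
def IsQuantumIdentityConnection (L : G.Ciliation) {n : ℕ} (q : ℂˣ) (Φ : SLConnection E n) : Prop :=
  (∀ e, (Φ e : Matrix (Fin n) (Fin n) ℂ).IsDiag) ∧
    ∀ d : E ⊕ E, G.leftFace d ≠ G.outer →
      G.faceMonodromy Φ d = quantumIdentityMatrix n q ^
        ((G.faceLength (G.leftFace d) : ℤ) / 2 - 1 - (L.inwardCilia (G.leftFace d) : ℤ))

/-- The identity connection: the identity matrix on every edge. -/
def identityConnection (E : Type*) (n : ℕ) : SLConnection E n := fun _ => 1

/-- A ciliation is trivial (for given `n` and `q`) if the identity connection is a quantum identity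
connection. -/
def Ciliation.IsTrivial (L : G.Ciliation) (n : ℕ) (q : ℂˣ) : Prop :=
  IsQuantumIdentityConnection L q (identityConnection E n)

/-- Every bounded face, of length `l`, has exactly `l / 2 - 1` inward-pointing cilia. -/
def Ciliation.IsFaceBalanced (L : G.Ciliation) : Prop :=
  ∀ f : G.Face, f ≠ G.outer → (L.inwardCilia f : ℚ) = (G.faceLength f : ℚ) / 2 - 1

end PlaneBipartiteGraph

/-! Part 1: the identity connection has monodromy 1, and the balance condition makes the exponent of
`Q` zero. Part 2: let `s`, `t` be the ends of an edge on the outer face. Without cut vertices there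
is an `st`-numbering `h` (`exists_stNumbering`); orient edges upwards. Call a sector lateral if it
lies between an incoming and an outgoing edge. Each vertex other than `s`, `t` has both kinds of
edges, hence at least two lateral sectors (`two_le_ncard_isLateral`). The boundary of a face of
length `l` turns at its minimum and maximum, leaving at most `l - 2` lateral sectors
(`ncard_isLateral_add_two_le`). By Euler's formula the numbers `l / 2 - 1`, summed over all faces,
give the number of vertices minus 2. Hall's theorem (`exists_choice_card_fiber_eq`) thus selects one
lateral sector per vertex, with exactly `l / 2 - 1` in each face. The cilia at `s` and `t` go into
the outer face, where nothing is required. -/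

/-! ### Sign changes along a cycle of a permutation. -/

namespace Equiv.Perm

theorem SameCycle.exists_true_apply_false {α : Type*} [Finite α] {σ : Equiv.Perm α}
    {f : α → Bool} {x y : α} (h : σ.SameCycle x y) (hx : f x = true) (hy : f y = false) :
    ∃ z, σ.SameCycle x z ∧ f z = true ∧ f (σ z) = false := by
  by_contra! H
  have key : ∀ n : ℕ, f ((σ ^ n) x) = true := by
    intro n
    induction n with
    | zero => simpa using hx
    | succ n ih =>
      have := H ((σ ^ n) x) ⟨n, by simp⟩ ih
      rw [pow_succ', mul_apply]
      simpa using this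
  obtain ⟨n, -, hn⟩ := h.exists_pow_eq'
  simpa [hn, hy] using key n

/-- A two-valued function that is not constant on a cycle changes its value at least twice
along that cycle. -/
theorem SameCycle.exists_ne_changes {α : Type*} [Finite α] {σ : Equiv.Perm α}
    {f : α → Bool} {x y : α} (h : σ.SameCycle x y) (hx : f x = true) (hy : f y = false) :
    ∃ z w, z ≠ w ∧ σ.SameCycle x z ∧ σ.SameCycle x w ∧ f z ≠ f (σ z) ∧ f w ≠ f (σ w) := by
  obtain ⟨z, hz, hz1, hz2⟩ := h.exists_true_apply_false hx hy
  obtain ⟨w, hw, hw1, hw2⟩ := h.symm.exists_true_apply_false (f := fun a => !f a)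
    (by simp [hy]) (by simp [hx])
  refine ⟨z, w, ?_, hz, h.trans hw, by simp [hz1, hz2], ?_⟩
  · rintro rfl
    simp [hz1] at hw1
  · simp only [Bool.not_eq_true', Bool.not_eq_false'] at hw1 hw2
    simp [hw1, hw2]

end Equiv.Perm

/-! ### Construction of `st`-numberings by adding ears. -/

namespace SimpleGraph

variable {V : Type*} {G : SimpleGraph V}

/-- `h` is injective on `A`, and every vertex of `A` outside `T` has a neighbour in `A` with a
smaller value and one with a larger value. -/
structure IsPartialNumbering (G : SimpleGraph V) (T A : Set V) (h : V → ℝ) : Prop where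
  injOn : Set.InjOn h A
  exists_lt : ∀ v ∈ A, v ∉ T → ∃ u ∈ A, G.Adj v u ∧ h u < h v
  exists_gt : ∀ v ∈ A, v ∉ T → ∃ u ∈ A, G.Adj v u ∧ h v < h u

/-- A partial numbering in which `z` may lack a larger neighbour is completed along a path from
`z` to a vertex with a larger value. -/
theorem exists_isPartialNumbering_of_walk {T : Set V} {z b : V} (p : G.Walk z b) (hp : p.IsPath)
    (A : Set V) (hfin : A.Finite) (h : V → ℝ) (hzA : z ∈ A) (hbA : b ∈ A) (hzb : h z < h b)
    (hpA : ∀ v ∈ p.support, v ∈ A → v = z ∨ v = b) (hinj : Set.InjOn h A)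
    (hlt : ∀ v ∈ A, v ∉ T → ∃ u ∈ A, G.Adj v u ∧ h u < h v)
    (hgt : ∀ v ∈ A, v ∉ T → v ≠ z → ∃ u ∈ A, G.Adj v u ∧ h v < h u) :
    ∃ h', G.IsPartialNumbering T (A ∪ {v | v ∈ p.support}) h' := by
  classical
  induction p generalizing A h with
  | nil => exact absurd hzb (lt_irrefl _)
  | @cons z x b hzx p ih =>
    rw [Walk.cons_isPath_iff] at hp
    by_cases hxA : x ∈ A
    · have hxb : x = b := by
        rcases hpA x (by simp) hxA with h1 | h1
        · exact absurd h1 hzx.ne'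
        · exact h1
      subst hxb
      obtain rfl : p = Walk.nil := Walk.eq_nil_iff_nil.2 (Walk.isPath_iff_nil.1 hp.1)
      refine ⟨h, ?_⟩
      have hA : A ∪ {v | v ∈ (Walk.cons hzx Walk.nil).support} = A := by
        ext v
        simp only [Walk.support_cons, Walk.support_nil, List.mem_cons, List.not_mem_nil, or_false,
          Set.mem_union, Set.mem_ofPred_eq]
        constructor
        · rintro (h1 | rfl | rfl) <;> assumption
        · exact Or.inl
      rw [hA]
      refine ⟨hinj, hlt, fun v hv hvT => ?_⟩
      by_cases hvz : v = z
      · subst hvz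
        exact ⟨x, hbA, hzx, hzb⟩
      · exact hgt v hv hvT hvz
    -- The new vertex `x` gets an unused value between those of `z` and `b`. Now `z` has a larger
    -- neighbour and `x` a smaller one, so only `x` may lack a larger one and takes over the role of
    -- `z`.
    · obtain ⟨r, ⟨hr1, hr2⟩, hrA⟩ :=
        ((Set.Ioo_infinite hzb).sdiff (hfin.image h)).nonempty
      have hne : ∀ v ∈ A, v ≠ x := fun v hv e => hxA (e ▸ hv)
      have hup : ∀ v ∈ A, Function.update h x r v = h v := fun v hv =>
        Function.update_of_ne (hne v hv) _ _
      have hx : Function.update h x r x = r := Function.update_self _ _ _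
      obtain ⟨h', hh'⟩ := ih hp.1 (insert x A) (hfin.insert x) (Function.update h x r)
        (by simp) (by simp [hbA]) (by rw [hx, hup b hbA]; exact hr2)
        (by
          rintro v hv (rfl | hvA)
          · exact Or.inl rfl
          · rcases hpA v (by simp [hv]) hvA with rfl | h1
            · exact absurd hv hp.2
            · exact Or.inr h1)
        (by
          rw [Set.injOn_insert hxA]
          constructor
          · intro v hv w hw
            rw [hup v hv, hup w hw]
            exact hinj hv hw
          · rintro ⟨v, hv, hvr⟩
            rw [hup v hv, hx] at hvr
            exact hrA ⟨v, hv, hvr⟩)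
        (by
          rintro v (rfl | hv) hvT
          · exact ⟨z, by simp [hzA], hzx.symm, by rw [hx, hup z hzA]; exact hr1⟩
          · obtain ⟨u, hu, huv, hl⟩ := hlt v hv hvT
            exact ⟨u, by simp [hu], huv, by rw [hup u hu, hup v hv]; exact hl⟩)
        (by
          rintro v (rfl | hv) hvT hvx
          · exact absurd rfl hvx
          · by_cases hvz : v = z
            · subst hvz
              exact ⟨x, by simp, hzx, by rw [hx, hup v hv]; exact hr1⟩
            · obtain ⟨u, hu, huv, hl⟩ := hgt v hv hvT hvz
              exact ⟨u, by simp [hu], huv, by rw [hup u hu, hup v hv]; exact hl⟩)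
      refine ⟨h', ?_⟩
      convert hh' using 1
      ext v
      have : x ∈ p.support := p.start_mem_support
      simp only [Walk.support_cons, List.mem_cons, Set.mem_union, Set.mem_ofPred_eq,
        Set.mem_insert_iff]
      constructor
      · rintro (h1 | rfl | h1) <;> simp [*]
      · rintro ((rfl | h1) | h1) <;> simp [*]

/-- The values are made to increase along the ear from its lower end to its upper end, so the path
is reversed if necessary. -/
theorem IsPartialNumbering.exists_of_path {T A : Set V} {h : V → ℝ}
    (H : G.IsPartialNumbering T A h) (hfin : A.Finite) {a b : V} (p : G.Walk a b) (hp : p.IsPath)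
    (ha : a ∈ A) (hb : b ∈ A) (hab : a ≠ b) (hpA : ∀ v ∈ p.support, v ∈ A → v = a ∨ v = b) :
    ∃ h', G.IsPartialNumbering T (A ∪ {v | v ∈ p.support}) h' := by
  rcases lt_or_gt_of_ne (fun e => hab (H.injOn ha hb e)) with hlt | hlt
  · exact exists_isPartialNumbering_of_walk p hp A hfin h ha hb hlt hpA H.injOn H.exists_lt
      fun v hv hvT _ => H.exists_gt v hv hvT
  · obtain ⟨h', hh'⟩ := exists_isPartialNumbering_of_walk p.reverse hp.reverse A hfin h hb ha hlt
      (fun v hv hvA => (hpA v (by simpa using hv) hvA).symm) H.injOn H.exists_lt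
      fun v hv hvT _ => H.exists_gt v hv hvT
    exact ⟨h', by simpa using hh'⟩

/-- A walk that ends in `A` contains a path that meets `A` only at its end. -/
theorem Walk.exists_isPath_first_hit {x b : V} (p : G.Walk x b) {A : Set V} (hb : b ∈ A) :
    ∃ c ∈ A, ∃ q : G.Walk x c, q.IsPath ∧ (∀ v ∈ q.support, v ∈ A → v = c) ∧
      ∀ v ∈ q.support, v ∈ p.support := by
  classical
  induction p with
  | nil => exact ⟨_, hb, Walk.nil, by simp, by simp, by simp⟩
  | @cons x y b hxy p ih =>
    by_cases hx : x ∈ A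
    · exact ⟨x, hx, Walk.nil, by simp, by simp, by simp⟩
    · obtain ⟨c, hc, q, -, hqA, hqp⟩ := ih hb
      refine ⟨c, hc, (Walk.cons hxy q).bypass, Walk.bypass_isPath _, fun v hv hvA => ?_,
        fun v hv => ?_⟩
      · have := Walk.support_bypass_subset_support _ hv
        rw [Walk.support_cons, List.mem_cons] at this
        rcases this with rfl | h1
        · exact absurd hvA hx
        · exact hqA v h1 hvA
      · have := Walk.support_bypass_subset_support _ hv
        rw [Walk.support_cons, List.mem_cons] at this ⊢
        exact this.imp_right (hqp v)

/-- In a graph without cut vertices, a proper set of at least two vertices has an ear. -/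
theorem exists_ear (hG : G.Connected) (hcut : ∀ v, (G.induce {v}ᶜ).Preconnected) {A : Set V}
    (hA : A.Nontrivial) (hAne : A ≠ Set.univ) :
    ∃ a ∈ A, ∃ b ∈ A, a ≠ b ∧ ∃ p : G.Walk a b, p.IsPath ∧
      (∀ v ∈ p.support, v ∈ A → v = a ∨ v = b) ∧ ∃ x ∈ p.support, x ∉ A := by
  obtain ⟨y, hy⟩ := (Set.ne_univ_iff_exists_notMem A).1 hAne
  obtain ⟨a₀, ha₀⟩ := hA.nonempty
  obtain ⟨w⟩ := hG.preconnected a₀ y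
  obtain ⟨d, -, hdA, hdx⟩ := w.exists_boundary_dart A ha₀ hy
  obtain ⟨⟨a, x⟩, hax⟩ := d
  simp only at hdA hdx hax
  obtain ⟨b₀, hb₀, hb₀a⟩ := hA.exists_ne a
  -- As `a` is no cut vertex, the way from `x` back to `A` can avoid `a`; this makes the ends of the
  -- ear distinct.
  obtain ⟨p₀⟩ := hcut a ⟨x, hax.ne'⟩ ⟨b₀, hb₀a⟩
  let p₁ : G.Walk x b₀ := p₀.map (Embedding.induce _).toHom
  obtain ⟨b, hb, q, hq, hqA, hqp⟩ := p₁.exists_isPath_first_hit hb₀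
  have haq : a ∉ q.support := by
    intro h1
    obtain ⟨⟨u, hu⟩, -, hua⟩ :=
      List.mem_map.1 ((Walk.support_map _ p₀) ▸ hqp a h1)
    exact hu hua
  have hab : a ≠ b := by
    rintro rfl
    exact haq q.end_mem_support
  refine ⟨a, hdA, b, hb, hab, Walk.cons hax q, (Walk.cons_isPath_iff _ _).2 ⟨hq, haq⟩, ?_,
    x, ?_, hdx⟩
  · intro v hv hvA
    rw [Walk.support_cons, List.mem_cons] at hv
    exact hv.imp_right fun h1 => hqA v h1 hvA
  · rw [Walk.support_cons]
    exact List.mem_cons_of_mem _ q.start_mem_support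

/-- A finite connected graph without cut vertices has an `st`-numbering for all distinct vertices
`s` and `t`. -/
theorem exists_stNumbering [Finite V] (hG : G.Connected)
    (hcut : ∀ v, (G.induce {v}ᶜ).Preconnected) {s t : V} (hst : s ≠ t) :
    ∃ h, G.IsPartialNumbering {s, t} Set.univ h := by
  have key : ∀ n : ℕ, ∀ A : Set V, ∀ h, {s, t} ⊆ A → Aᶜ.ncard ≤ n →
      G.IsPartialNumbering {s, t} A h → ∃ h, G.IsPartialNumbering {s, t} Set.univ h := by
    intro n
    induction n with
    | zero =>
      intro A h _ hn H
      have : A = Set.univ := by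
        rw [Nat.le_zero, Set.ncard_eq_zero, Set.compl_empty_iff] at hn
        exact hn
      exact ⟨h, this ▸ H⟩
    | succ n ih =>
      intro A h hst' hn H
      by_cases hA : A = Set.univ
      · exact ⟨h, hA ▸ H⟩
      obtain ⟨a, ha, b, hb, hab, p, hp, hpA, x, hxp, hxA⟩ := exists_ear hG hcut
        ((Set.nontrivial_pair hst).mono hst') hA
      obtain ⟨h', H'⟩ := H.exists_of_path A.toFinite p hp ha hb hab hpA
      refine ih _ h' (hst'.trans Set.subset_union_left) ?_ H'
      have : (A ∪ {v | v ∈ p.support})ᶜ ⊂ Aᶜ := by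
        refine ⟨Set.compl_subset_compl.2 Set.subset_union_left, fun h1 => ?_⟩
        exact h1 hxA (Or.inr hxp)
      have := Set.ncard_lt_ncard this
      omega
  classical
  refine key _ {s, t} (fun v => if v = s then 0 else 1) le_rfl le_rfl ⟨?_, ?_, ?_⟩
  · rintro v (rfl | rfl) w (rfl | rfl) <;> simp [hst.symm]
  · exact fun v hv hv' => absurd hv hv'
  · exact fun v hv hv' => absurd hv hv'

end SimpleGraph

/-! ### Selection by Hall's theorem. -/

open Finset in
/-- A consequence of Hall's theorem: if pairwise disjoint sets `t v` of at least two elements each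
are given, and `face` takes each value `f` on at most `2 * g f` of these elements, where `∑ g` is
the number of the sets, then one can choose an element of each set so that `face` takes each value
`f` exactly `g f` times. -/
theorem exists_choice_card_fiber_eq {ι D F : Type*} [Finite ι] [Fintype F] (t : ι → Finset D)
    (face : D → F) (g : F → ℕ) (hdisj : Pairwise fun v w => Disjoint (t v) (t w))
    (ht : ∀ v, 2 ≤ (t v).card)
    (hF : ∀ (f : F) (u : Finset D), (∀ d ∈ u, face d = f ∧ ∃ v, d ∈ t v) → u.card ≤ 2 * g f)
    (hsum : ∑ f, g f = Nat.card ι) :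
    ∃ c : ι → D, (∀ v, c v ∈ t v) ∧ ∀ f, Nat.card {v // face (c v) = f} = g f := by
  classical
  have := Fintype.ofFinite ι
  -- Each `f` offers `g f` slots, and `v` may use every slot of every value that `face` takes on `t
  -- v`.
  let T : ι → Finset (Σ f, Fin (g f)) := fun v => univ.filter fun x => ∃ d ∈ t v, face d = x.1
  have hall : ∀ s : Finset ι, s.card ≤ (s.biUnion T).card := by
    intro s
    set N : Finset F := (s.biUnion t).image face with hN
    have h1 : 2 * s.card ≤ (s.biUnion t).card := by
      rw [card_biUnion fun v _ w _ hvw => hdisj hvw, mul_comm, ← smul_eq_mul]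
      exact card_nsmul_le_sum _ _ _ fun v _ => ht v
    have h2 : (s.biUnion t).card = ∑ f ∈ N, ((s.biUnion t).filter (face · = f)).card :=
      card_eq_sum_card_fiberwise fun d hd => mem_image_of_mem _ hd
    have h3 : ∑ f ∈ N, ((s.biUnion t).filter (face · = f)).card ≤ ∑ f ∈ N, 2 * g f := by
      refine sum_le_sum fun f _ => hF f _ fun d hd => ?_
      rw [mem_filter, mem_biUnion] at hd
      obtain ⟨⟨v, -, hv⟩, hd⟩ := hd
      exact ⟨hd, v, hv⟩
    have h4 : N.sigma (fun f => (univ : Finset (Fin (g f)))) ⊆ s.biUnion T := by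
      rintro ⟨f, i⟩ hx
      rw [mem_sigma, hN, mem_image] at hx
      obtain ⟨⟨d, hd, hdf⟩, -⟩ := hx
      obtain ⟨v, hv, hdv⟩ := mem_biUnion.1 hd
      exact mem_biUnion.2 ⟨v, hv, mem_filter.2 ⟨mem_univ _, d, hdv, hdf⟩⟩
    have h5 := card_le_card h4
    rw [card_sigma] at h5
    simp only [card_univ, Fintype.card_fin] at h5
    rw [← mul_sum] at h3
    omega
  obtain ⟨φ, hφ, hφT⟩ := (Finset.all_card_le_biUnion_card_iff_exists_injective T).1 hall
  -- There are as many slots as sets, so the matching fills every slot; this turns "at most" into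
  -- "exactly".
  have hbij : Function.Bijective φ := by
    rw [Fintype.bijective_iff_injective_and_card]
    refine ⟨hφ, ?_⟩
    rw [Fintype.card_sigma, ← Nat.card_eq_fintype_card, ← hsum]
    simp
  have hex : ∀ v, ∃ d ∈ t v, face d = (φ v).1 := fun v => (mem_filter.1 (hφT v)).2
  choose c hc hcf using hex
  refine ⟨c, hc, fun f => ?_⟩
  have e : {v // face (c v) = f} ≃ {x : Σ f, Fin (g f) // x.1 = f} :=
    (Equiv.ofBijective φ hbij).subtypeEquiv fun v => by rw [hcf]; rfl
  rw [Nat.card_congr (e.trans (Equiv.sigmaSubtype f)), Nat.card_fin]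

/-! ### Counting lateral sectors at vertices and in faces. -/

namespace BipartiteRotationSystem

variable {B W E : Type*} (G : BipartiteRotationSystem B W E)

instance [Finite E] : Finite G.Face := inferInstanceAs (Finite (Quotient _))

theorem base_rot (d : E ⊕ E) : G.base (G.rot d) = G.base d :=
  (G.sameCycle_rot_iff _ _).1 (Equiv.Perm.SameCycle.symm ⟨1, by simp⟩)

theorem base_rot_symm (d : E ⊕ E) : G.base (G.rot.symm d) = G.base d := by
  rw [← base_rot, Equiv.apply_symm_apply]

theorem base_facePerm (d : E ⊕ E) : G.base (G.facePerm d) = G.base d.swap :=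
  G.base_rot_symm _

theorem rot_facePerm (d : E ⊕ E) : G.rot (G.facePerm d) = d.swap := by
  simp [facePerm]

theorem base_swap_ne (d : E ⊕ E) : G.base d ≠ G.base d.swap := by
  cases d <;> simp [base]

theorem leftFace_eq_iff (d d' : E ⊕ E) :
    G.leftFace d = G.leftFace d' ↔ G.facePerm.SameCycle d d' :=
  Quotient.eq (r := Equiv.Perm.SameCycle.setoid G.facePerm)

theorem exists_leftFace_eq (f : G.Face) : ∃ d, G.leftFace d = f :=
  Quotient.exists_rep f

theorem sum_faceLength [Finite E] [Fintype G.Face] : ∑ f, G.faceLength f = 2 * Nat.card E := by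
  simp only [faceLength]
  rw [← Nat.card_sigma, Nat.card_congr (Equiv.sigmaFiberEquiv G.leftFace), Nat.card_sum, two_mul]

open Classical in
/-- Whether a function on the vertices increases along a dart. -/
noncomputable def rises (h : B ⊕ W → ℝ) (d : E ⊕ E) : Bool :=
  decide (h (G.base d) < h (G.base d.swap))

/-- The sector between `d` and `G.rot d` is lateral if the function `h` increases along exactly one
of these two darts. -/
def IsLateral (h : B ⊕ W → ℝ) (d : E ⊕ E) : Prop := G.rises h d ≠ G.rises h (G.rot d)

variable {G} {h : B ⊕ W → ℝ}

theorem rises_swap (hh : Function.Injective h) (d : E ⊕ E) :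
    G.rises h d.swap = !G.rises h d := by
  have := hh.ne (G.base_swap_ne d)
  rcases lt_or_gt_of_ne this with h1 | h1 <;> simp [rises, h1, h1.le]

theorem two_le_ncard_isLateral [Finite E] {v : B ⊕ W}
    (hlt : ∃ u, G.graph.Adj v u ∧ h u < h v) (hgt : ∃ u, G.graph.Adj v u ∧ h v < h u) :
    2 ≤ {d | G.base d = v ∧ G.IsLateral h d}.ncard := by
  obtain ⟨_, ⟨y, rfl, rfl⟩, hy⟩ := hlt
  obtain ⟨_, ⟨x, hx, rfl⟩, hxy⟩ := hgt
  have hcyc : G.rot.SameCycle x y := (G.sameCycle_rot_iff _ _).2 hx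
  obtain ⟨z, w, hzw, hz, hw, hz', hw'⟩ := hcyc.exists_ne_changes (f := G.rises h)
    (by simpa [rises, hx] using hxy) (by simpa [rises] using hy.le)
  have hb : ∀ z, G.rot.SameCycle x z → G.base z = G.base y := fun z hz =>
    ((G.sameCycle_rot_iff _ _).1 (hz.symm.trans hcyc))
  rw [← Set.ncard_pair hzw]
  refine Set.ncard_le_ncard ?_ (Set.toFinite _)
  rintro _ (rfl | rfl)
  exacts [⟨hb _ hz, hz'⟩, ⟨hb _ hw, hw'⟩]

/-- The sector between consecutive boundary darts is bounded by the second dart and the reversal of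
the first, so it is non-lateral exactly when the boundary walk changes between rising and falling.
This happens at least twice. -/
theorem ncard_isLateral_add_two_le [Finite E] (hh : Function.Injective h) (f : G.Face) :
    {d | G.leftFace d = f ∧ G.IsLateral h d}.ncard + 2 ≤ G.faceLength f := by
  obtain ⟨d₀, hd₀⟩ := G.exists_leftFace_eq f
  have hfin : {d | G.leftFace d = f}.Finite := Set.toFinite _
  obtain ⟨y, hy, hymax⟩ := Set.exists_max_image _ (fun d => h (G.base d)) hfin ⟨d₀, hd₀⟩
  obtain ⟨x, hx, hxmin⟩ := Set.exists_min_image _ (fun d => h (G.base d)) hfin ⟨d₀, hd₀⟩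
  simp only [Set.mem_ofPred_eq] at hy hx hymax hxmin
  have hfy : G.rises h y = false := by
    have := hymax (G.facePerm y) (by rw [leftFace_facePerm, hy])
    rw [base_facePerm] at this
    simpa [rises] using this
  have hfx : G.rises h x = true := by
    have := hxmin (G.facePerm x) (by rw [leftFace_facePerm, hx])
    rw [base_facePerm] at this
    simpa [rises] using lt_of_le_of_ne this (hh.ne (G.base_swap_ne x))
  have hcyc : G.facePerm.SameCycle x y := (G.leftFace_eq_iff _ _).1 (hx.trans hy.symm)
  obtain ⟨z, w, hzw, hz, hw, hz', hw'⟩ := hcyc.exists_ne_changes hfx hfy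
  have hmem : ∀ z, G.facePerm.SameCycle x z → G.rises h z ≠ G.rises h (G.facePerm z) →
      G.leftFace (G.facePerm z) = f ∧ ¬ G.IsLateral h (G.facePerm z) := by
    intro z hz hz'
    refine ⟨by rw [leftFace_facePerm, ← (G.leftFace_eq_iff _ _).2 hz, hx], ?_⟩
    rw [IsLateral, rot_facePerm, rises_swap hh, not_not]
    revert hz'
    cases G.rises h z <;> cases G.rises h (G.facePerm z) <;> simp
  have h2 : 2 ≤ {d | G.leftFace d = f ∧ ¬ G.IsLateral h d}.ncard := by
    rw [← Set.ncard_pair (G.facePerm.injective.ne hzw)]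
    refine Set.ncard_le_ncard ?_ (Set.toFinite _)
    rintro _ (rfl | rfl)
    exacts [hmem _ hz hz', hmem _ hw hw']
  have hdisj : Disjoint {d | G.leftFace d = f ∧ G.IsLateral h d}
      {d | G.leftFace d = f ∧ ¬ G.IsLateral h d} :=
    Set.disjoint_left.2 fun d hd hd' => hd'.2 hd.2
  calc _ ≤ _ := Nat.add_le_add_left h2 _
    _ = _ := (Set.ncard_union_eq hdisj (Set.toFinite _) (Set.toFinite _)).symm
    _ ≤ {d | G.leftFace d = f}.ncard := by
      refine Set.ncard_le_ncard ?_ (Set.toFinite _)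
      rintro d (hd | hd) <;> exact hd.1
    _ = _ := rfl

theorem two_le_faceLength [Finite E] [Finite B] [Finite W] (f : G.Face) : 2 ≤ G.faceLength f := by
  -- The bound on lateral sectors holds for every injective height function; any one will do.
  obtain ⟨h, hh⟩ := Countable.exists_injective_nat (B ⊕ W)
  have := ncard_isLateral_add_two_le (h := fun v => (h v : ℝ))
    (Nat.cast_injective.comp hh) f
  omega

end BipartiteRotationSystem

/-! ### Balanced ciliations: triviality and existence. -/

namespace PlaneBipartiteGraph

variable {B W E : Type*} {G : PlaneBipartiteGraph B W E}

theorem Ciliation.IsFaceBalanced.isTrivial [Finite E] {L : G.Ciliation} (hL : L.IsFaceBalanced)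
    (n : ℕ) (q : ℂˣ) : L.IsTrivial n q := by
  refine ⟨fun e => ?_, fun d hd => ?_⟩
  · simp [identityConnection]
  · have htr : transport (identityConnection E n) = fun _ => 1 := by
      funext d
      cases d <;> simp [transport, identityConnection]
    have hmon : G.faceMonodromy (identityConnection E n) d = 1 := by
      simp [faceMonodromy, htr]
    obtain ⟨m, hm⟩ := G.even_faceLength (G.leftFace d)
    have hbal := hL _ hd
    rw [hm] at hbal
    have hk : (L.inwardCilia (G.leftFace d) : ℤ) = m - 1 := by
      have : (L.inwardCilia (G.leftFace d) : ℚ) = m - 1 := by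
        rw [hbal]; push_cast; ring
      exact_mod_cast this
    have hexp : (G.faceLength (G.leftFace d) : ℤ) / 2 - 1 -
        (L.inwardCilia (G.leftFace d) : ℤ) = 0 := by
      rw [hk, hm]; push_cast; omega
    rw [hmon, hexp, zpow_zero]

/-- The ciliation whose cilium at `v` is drawn between `c v` and the next half-edge
counterclockwise. -/
def Ciliation.ofBeforeCilium (c : B ⊕ W → E ⊕ E) (hc : ∀ v, G.base (c v) = v) : G.Ciliation where
  first
    | Sum.inl b => G.rot (c (Sum.inl b))
    | Sum.inr w => c (Sum.inr w)
  base_first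
    | Sum.inl _ => (G.base_rot _).trans (hc _)
    | Sum.inr _ => hc _

theorem Ciliation.ciliumFace_ofBeforeCilium (c : B ⊕ W → E ⊕ E) (hc : ∀ v, G.base (c v) = v)
    (v : B ⊕ W) : (Ciliation.ofBeforeCilium c hc).ciliumFace v = G.leftFace (c v) := by
  cases v <;> simp [ciliumFace, beforeCilium, ofBeforeCilium]

/-- Face lengths are even and at least 2, so nothing is lost in the natural-number operations. They
add up to twice the number of edges, and Euler's formula does the rest. -/
theorem sum_faceLength_div_two_sub_one [Finite B] [Finite W] [Finite E] [Fintype G.Face]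
    {s t : B ⊕ W} (hst : s ≠ t) :
    ∑ f : G.Face, (G.faceLength f / 2 - 1) = Nat.card {v // v ≠ s ∧ v ≠ t} := by
  have h1 : ∀ f : G.Face, G.faceLength f = 2 * (G.faceLength f / 2 - 1) + 2 := by
    intro f
    obtain ⟨m, hm⟩ := G.even_faceLength f
    have := BipartiteRotationSystem.two_le_faceLength f
    omega
  have h2 := G.sum_faceLength
  rw [Finset.sum_congr rfl fun f _ => h1 f, Finset.sum_add_distrib, ← Finset.mul_sum] at h2
  simp only [Finset.sum_const, Finset.card_univ, smul_eq_mul] at h2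
  have h3 := G.euler
  rw [Nat.card_eq_fintype_card (α := G.Face)] at h3
  have h4 : Nat.card {v // v ≠ s ∧ v ≠ t} + 2 = Nat.card (B ⊕ W) := by
    have h5 := Set.ncard_add_ncard_compl ({s, t} : Set (B ⊕ W))
    rw [Set.ncard_pair hst] at h5
    have h6 : Nat.card {v // v ≠ s ∧ v ≠ t} = ({s, t} : Set (B ⊕ W))ᶜ.ncard :=
      Nat.card_congr (Equiv.subtypeEquivRight fun v => by simp [not_or])
    omega
  omega

theorem exists_isFaceBalanced [Finite B] [Finite W] [Finite E] (hG : G.IsTwoConnected) :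
    ∃ L : G.Ciliation, L.IsFaceBalanced := by
  classical
  have := Fintype.ofFinite E
  have := Fintype.ofFinite G.Face
  obtain ⟨o, ho⟩ := G.exists_leftFace_eq G.outer
  set s := G.base o with hs
  set t := G.base o.swap with ht
  have hst : s ≠ t := G.base_swap_ne o
  obtain ⟨h, hh⟩ := SimpleGraph.exists_stNumbering G.connected hG hst
  have hinj : Function.Injective h := Set.injOn_univ.1 hh.injOn
  obtain ⟨c, hc, hcard⟩ := exists_choice_card_fiber_eq
    (ι := {v // v ≠ s ∧ v ≠ t})
    (fun v => Finset.univ.filter fun d => G.base d = v ∧ G.IsLateral h d)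
    G.leftFace (fun f => G.faceLength f / 2 - 1)
    (fun v w hvw => Finset.disjoint_left.2 fun d hd hd' => hvw (Subtype.ext <|
      ((Finset.mem_filter.1 hd).2.1).symm.trans (Finset.mem_filter.1 hd').2.1))
    (fun v => by
      have hv : (v : B ⊕ W) ∉ ({s, t} : Set (B ⊕ W)) := by simp [v.2.1, v.2.2]
      obtain ⟨u, -, hu⟩ := hh.exists_lt v trivial hv
      obtain ⟨u', -, hu'⟩ := hh.exists_gt v trivial hv
      have := BipartiteRotationSystem.two_le_ncard_isLateral ⟨u, hu⟩ ⟨u', hu'⟩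
      rw [← Set.ncard_coe_finset]
      simpa using this)
    (fun f u hu => by
      have h1 := BipartiteRotationSystem.ncard_isLateral_add_two_le hinj f
      have h2 : u.card ≤ {d | G.leftFace d = f ∧ G.IsLateral h d}.ncard := by
        rw [← Set.ncard_coe_finset]
        refine Set.ncard_le_ncard (fun d hd => ?_) (Set.toFinite _)
        obtain ⟨hdf, v, hv⟩ := hu d hd
        exact ⟨hdf, (Finset.mem_filter.1 hv).2.2⟩
      obtain ⟨m, hm⟩ := G.even_faceLength f
      omega)
    (sum_faceLength_div_two_sub_one hst)
  -- The darts `o` and `G.facePerm o` start at `s` and `t`, and both have the outer face on their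
  -- left.
  let c' : B ⊕ W → E ⊕ E := fun v =>
    if hv : v ≠ s ∧ v ≠ t then c ⟨v, hv⟩ else if v = s then o else G.facePerm o
  have hc' : ∀ v, G.base (c' v) = v := by
    intro v
    by_cases hv : v ≠ s ∧ v ≠ t
    · simp only [c', dif_pos hv]
      exact (Finset.mem_filter.1 (hc ⟨v, hv⟩)).2.1
    · by_cases hvs : v = s
      · simp [c', hvs, hs]
      · have hvt : v = t := by tauto
        simp only [c', dif_neg hv, if_neg hvs]
        rw [G.base_facePerm, hvt]
  have hc'_out : ∀ v, ¬ (v ≠ s ∧ v ≠ t) → G.leftFace (c' v) = G.outer := by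
    intro v hv
    simp only [c', dif_neg hv]
    split_ifs
    · exact ho
    · rw [G.leftFace_facePerm, ho]
  refine ⟨Ciliation.ofBeforeCilium c' hc', fun f hf => ?_⟩
  have e : {v // (Ciliation.ofBeforeCilium c' hc').ciliumFace v = f} ≃
      {v // G.leftFace (c v) = f} :=
    { toFun := fun v =>
        have hv : v.1 ≠ s ∧ v.1 ≠ t := by
          by_contra hv
          have h1 := v.2
          rw [Ciliation.ciliumFace_ofBeforeCilium, hc'_out _ hv] at h1
          exact hf h1.symm
        ⟨⟨v.1, hv⟩, by
          have h1 := v.2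
          rw [Ciliation.ciliumFace_ofBeforeCilium] at h1
          simpa only [c', dif_pos hv] using h1⟩
      invFun := fun v => ⟨v.1.1, by
        rw [Ciliation.ciliumFace_ofBeforeCilium]
        simpa only [c', dif_pos v.1.2] using v.2⟩
      left_inv := fun v => rfl
      right_inv := fun v => rfl }
  have h1 : (Ciliation.ofBeforeCilium c' hc').inwardCilia f = G.faceLength f / 2 - 1 :=
    (Nat.card_congr e).trans (hcard f)
  obtain ⟨m, hm⟩ := G.even_faceLength f
  have h2 := BipartiteRotationSystem.two_le_faceLength f
  have h3 : (Ciliation.ofBeforeCilium c' hc').inwardCilia f + 1 = m := by omega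
  rw [hm, ← h3]
  push_cast
  ring

end PlaneBipartiteGraph

theorem mainTheorem7 {B W E : Type*} [Finite B] [Finite W] [Finite E]
    (G : PlaneBipartiteGraph B W E) (hG : G.IsTwoConnected) :
    (∀ L : G.Ciliation, L.IsFaceBalanced → ∀ (n : ℕ) (q : ℂˣ), L.IsTrivial n q) ∧
      ∃ L : G.Ciliation, L.IsFaceBalanced ∧ ∀ (n : ℕ) (q : ℂˣ), L.IsTrivial n q := by
  obtain ⟨L, hL⟩ := PlaneBipartiteGraph.exists_isFaceBalanced hG
  exact ⟨fun L hL => hL.isTrivial, L, hL, hL.isTrivial⟩
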